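/- Let $1 \le m \le n-1$, let $P \subset \mathbb{R}^n$ be an $n$-dimensional polytope with vertex set $\mathcal{V}(P)$, let $S \subseteq \mathcal{V}(P)$ be a set of $m+1$ vertices of $P$, and let $\Sigma = \operatorname{conv}(S)$. Call $\Sigma$ a special $m$-simplex of $P$ if the points of $S$ are affinely independent and every facet of $P$ contains exactly $m$ of the $m+1$ points of $S$. Then $\Sigma$ is a special $m$-simplex of $P$ if and only if the following two conditions hold. (a) For every affine hyperplane $H \subset \mathbb{R}^n$ with $\Sigma \subset H$ there are vertices $v, w \in \mathcal{V}(P) \setminus S$ lying strictly on different sides of $H$. (b) There is a basis polytope $Q \subset \mathbb{R}^{n-m}$ of $P$ with respect to $\Sigma$, i.e. $Q = \pi(P)$ for a surjective linear map $\pi : \mathbb{R}^n \to \mathbb{R}^{n-m}$ whose kernel is the linear subspace parallel to the affine hull of $\Sigma$, such that the complex of all faces of $P$ that contain no point of $S$ is combinatorially isomorphic to the boundary complex of $Q$ (the complex of all faces of $Q$ other than $Q$); that is, the two sets of faces (each including the empty face), partially ordered by inclusion, are isomorphic. -/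

import Mathlib

namespace SpecialSimplex

section General

variable {E : Type*} [NormedAddCommGroup E] [NormedSpace ℝ E]

/-- A polytope is the convex hull of a finite set of points. -/
def IsPolytope (P : Set E) : Prop :=
  ∃ A : Finset E, P = convexHull ℝ (A : Set E)

open Classical in
/-- The dimension of a set is the dimension of its affine hull, and `-1` for the empty set. -/
noncomputable def affDim (A : Set E) : ℤ :=
  if A = ∅ then -1 else (Module.finrank ℝ (affineSpan ℝ A).direction : ℤ)

/-- The set of vertices of a polytope. -/
def vertices (P : Set E) : Set E := P.extremePoints ℝ

/-- The face complex of `P`: all faces of `P`, including `∅` and `P` itself. -/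
def faces (P : Set E) : Set (Set E) := {F | IsExposed ℝ P F}

/-- A facet of `P` is a face whose dimension is one less than that of `P`. -/
def IsFacet (P F : Set E) : Prop :=
  F ∈ faces P ∧ affDim F = affDim P - 1

/-- The boundary complex of `P`: all faces of `P` other than `P`, including `∅`. -/
def boundaryComplex (P : Set E) : Set (Set E) := {F ∈ faces P | F ≠ P}

/-- The subcomplex of the face complex of `P` formed by the faces containing no vertex in `S`. -/
def deletion (P : Set E) (S : Finset E) : Set (Set E) := {F ∈ faces P | ∀ v ∈ S, v ∉ F}

/-- Two complexes are isomorphic if they are isomorphic as sets partially ordered by inclusion. -/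
def Isomorphic {E' : Type*} (K : Set (Set E)) (L : Set (Set E')) : Prop :=
  Nonempty (K ≃o L)

/-- `S` is the vertex set of a special `m`-simplex of `P`: its elements are `m + 1` affinely
independent vertices of `P`, and every facet of `P` contains exactly `m` of them. -/
structure IsSpecialSimplex (m : ℕ) (P : Set E) (S : Finset E) : Prop where
  subset_vertices : (S : Set E) ⊆ vertices P
  card_eq : S.card = m + 1
  affineIndependent : AffineIndependent ℝ (fun v : S => (v : E))
  facet_inter : ∀ F : Set E, IsFacet P F → ((S : Set E) ∩ F).ncard = m

/-- Every hyperplane `{x | f x = c}` containing the convex hull of `S` has vertices of `P` outside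
`S` strictly on both sides. -/
def HyperplanesSeparate (P : Set E) (S : Finset E) : Prop :=
  ∀ (f : E →L[ℝ] ℝ) (c : ℝ), f ≠ 0 → convexHull ℝ (S : Set E) ⊆ {x | f x = c} →
    ∃ v ∈ vertices P \ (S : Set E), ∃ w ∈ vertices P \ (S : Set E), c < f v ∧ f w < c

end General

/-- `Q ⊆ ℝ^(n - m)` is a basis polytope of `P ⊆ ℝ^n` with respect to `S`: the image of `P` under a
projection of `ℝ^n` onto `ℝ^(n - m)` whose kernel is the linear subspace parallel to the affine
hull of `S`. -/
def IsBasisPolytope {n : ℕ} (m : ℕ) (P : Set (EuclideanSpace ℝ (Fin n)))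
    (S : Finset (EuclideanSpace ℝ (Fin n))) (Q : Set (EuclideanSpace ℝ (Fin (n - m)))) : Prop :=
  ∃ π : EuclideanSpace ℝ (Fin n) →ₗ[ℝ] EuclideanSpace ℝ (Fin (n - m)),
    Function.Surjective π ∧
    LinearMap.ker π = (affineSpan ℝ (S : Set (EuclideanSpace ℝ (Fin n)))).direction ∧
    Q = π '' P

end SpecialSimplex

/-! If `S` is special, each facet misses exactly one point of `S`, so its slack, scaled to be 1
there, restricts to a barycentric coordinate on the simplex. Given a face `F` avoiding `S`, choose
for each `s` in `S` a facet through `F` missing `s`; the scaled slacks add up to a function equal to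
1 on all of `S`. Hence `F` is cut out by a functional constant on `S` (`exists_exposing_const`).
Such a functional factors through `π`, so image and preimage under `π` are inverse bijections
between the faces avoiding `S` and the proper faces of `π '' P`. Condition (a) is what keeps
preimages of proper faces away from `S`.

Conversely, rank-nullity for `π` gives affine independence, and (a) forbids a facet containing all
of `S`. For the lower bound, let a facet contain `k` points of `S`. Passing to subfaces that avoid
them costs at most `k` dimensions (`exists_face_avoiding`) and ends in a face of dimension at least
`n - 1 - k` that avoids `S`. The isomorphism sends chains of faces to chains, so this dimension is
less than `n - m` (`affDim_lt_finrank_of_isomorphic`), whence `k ≥ m`. -/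

namespace SpecialSimplex

/-! ### Faces, dimensions and facets of polytopes -/

section FaceTheory

variable {E : Type*} [NormedAddCommGroup E] [NormedSpace ℝ E]

/-- The faces of `P`, the empty one included, are the sets cut out by valid inequalities. -/
theorem mem_faces_iff {P F : Set E} :
    F ∈ faces P ↔ ∃ (l : E →L[ℝ] ℝ) (c : ℝ), (∀ x ∈ P, l x ≤ c) ∧ F = {x ∈ P | l x = c} := by
  constructor
  · intro h
    rcases F.eq_empty_or_nonempty with rfl | hne
    · refine ⟨0, 1, by simp, ?_⟩
      ext x
      simp
    · obtain ⟨l, hl⟩ := h hne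
      obtain ⟨x₀, hx₀⟩ := hne
      have hx₀' := hx₀
      rw [hl] at hx₀'
      refine ⟨l, l x₀, hx₀'.2, ?_⟩
      rw [hl]
      ext x
      constructor
      · exact fun hx => ⟨hx.1, le_antisymm (hx₀'.2 x hx.1) (hx.2 x₀ hx₀'.1)⟩
      · exact fun hx => ⟨hx.1, fun y hy => hx.2 ▸ hx₀'.2 y hy⟩
  · rintro ⟨l, c, hle, rfl⟩ ⟨x₀, hx₀⟩
    refine ⟨l, ?_⟩
    ext x
    constructor
    · exact fun hx => ⟨hx.1, fun y hy => hx.2 ▸ hle y hy⟩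
    · exact fun hx => ⟨hx.1, le_antisymm (hle x hx.1) (hx₀.2 ▸ hx.2 x₀ hx₀.1)⟩

theorem subset_of_mem_faces {P F : Set E} (h : F ∈ faces P) : F ⊆ P := by
  obtain ⟨l, c, -, rfl⟩ := mem_faces_iff.1 h
  exact fun x hx => hx.1

theorem empty_mem_faces (P : Set E) : ∅ ∈ faces P := fun h => by simp at h

theorem le_of_mem_convexHull {A : Set E} {l : E →L[ℝ] ℝ} {c : ℝ} (h : ∀ a ∈ A, l a ≤ c) :
    ∀ x ∈ convexHull ℝ A, l x ≤ c :=
  convexHull_min h (convex_halfSpace_le l.isLinear c)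

open Classical in
/-- A face of a polytope is spanned by the generators it contains. -/
theorem face_convexHull_eq {A : Finset E} {l : E →L[ℝ] ℝ} {c : ℝ} (h : ∀ a ∈ A, l a ≤ c) :
    {x ∈ convexHull ℝ (A : Set E) | l x = c} =
      convexHull ℝ ((A.filter fun a => l a = c : Finset E) : Set E) := by
  apply Set.Subset.antisymm
  · rintro x ⟨hx, hlx⟩
    obtain ⟨w, hw, hsum, rfl⟩ := Finset.mem_convexHull'.1 hx
    -- The weighted slacks are nonnegative and sum to the slack of the point, which is 0.
    have hz : ∀ a ∈ A, w a * (c - l a) = 0 := by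
      apply (Finset.sum_eq_zero_iff_of_nonneg
        (fun a ha => mul_nonneg (hw a ha) (sub_nonneg.2 (h a ha)))).1
      simp only [mul_sub, Finset.sum_sub_distrib, ← Finset.sum_mul, hsum]
      simp only [map_sum, map_smul, smul_eq_mul] at hlx
      rw [hlx]
      ring
    have hz' : ∀ a ∈ A, l a ≠ c → w a = 0 := fun a ha hne =>
      (mul_eq_zero.1 (hz a ha)).resolve_right (sub_ne_zero.2 (Ne.symm hne))
    refine Finset.mem_convexHull'.2 ⟨w, fun a ha => hw a (Finset.mem_filter.1 ha).1, ?_, ?_⟩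
    · rw [← hsum]
      refine Finset.sum_subset (Finset.filter_subset _ _) fun a ha hna => hz' a ha fun hc => ?_
      exact hna (Finset.mem_filter.2 ⟨ha, hc⟩)
    · refine Finset.sum_subset (Finset.filter_subset _ _) fun a ha hna => ?_
      rw [hz' a ha fun hc => hna (Finset.mem_filter.2 ⟨ha, hc⟩), zero_smul]
  · refine fun x hx => ⟨convexHull_mono (Finset.coe_subset.2 (Finset.filter_subset _ _)) hx, ?_⟩
    exact convexHull_min (t := {x | l x = c}) (fun a ha => (Finset.mem_filter.1 ha).2)
      (convex_hyperplane l.isLinear c) hx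

theorem IsPolytope.of_mem_faces {P F : Set E} (hP : IsPolytope P) (hF : F ∈ faces P) :
    IsPolytope F := by
  classical
  obtain ⟨A, rfl⟩ := hP
  obtain ⟨l, c, hle, rfl⟩ := mem_faces_iff.1 hF
  exact ⟨_, face_convexHull_eq fun a ha => hle a (subset_convexHull ℝ _ ha)⟩

/-- An inequality valid on the generators whose tight generators are those of the face `F` cuts
out `F`. -/
theorem eq_face_of_tight_iff {A : Finset E} {F : Set E}
    (hF : F ∈ faces (convexHull ℝ (A : Set E))) {l : E →L[ℝ] ℝ} {c : ℝ} (h : ∀ a ∈ A, l a ≤ c)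
    (hiff : ∀ a ∈ A, l a = c ↔ a ∈ F) : F = {x ∈ convexHull ℝ (A : Set E) | l x = c} := by
  classical
  obtain ⟨l', c', hle', rfl⟩ := mem_faces_iff.1 hF
  have hle : ∀ a ∈ A, l' a ≤ c' := fun a ha => hle' a (subset_convexHull ℝ _ ha)
  rw [face_convexHull_eq h, face_convexHull_eq hle]
  congr 2
  refine Finset.filter_congr fun a ha => ?_
  rw [hiff a ha]
  exact ⟨fun h => ⟨subset_convexHull ℝ _ ha, h⟩, fun h => h.2⟩

/-- A face of a face of a polytope is a face. -/
theorem faces_trans {P F G : Set E} (hP : IsPolytope P) (hF : F ∈ faces P) (hG : G ∈ faces F) :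
    G ∈ faces P := by
  classical
  obtain ⟨A, rfl⟩ := hP
  obtain ⟨l, c, hle, rfl⟩ := mem_faces_iff.1 hF
  obtain ⟨l', c', hle', rfl⟩ := mem_faces_iff.1 hG
  have hA : ∀ a ∈ A, a ∈ convexHull ℝ (A : Set E) := fun a ha => subset_convexHull ℝ _ ha
  -- The inequality for `G` is valid only on `F`; adding `N` times the slack of `l` makes it strict
  -- at every generator off `F`.
  obtain ⟨N, hN⟩ : ∃ N : ℝ, ∀ a ∈ A, l a ≠ c → l' a - c' < N * (c - l a) := by
    obtain ⟨M, hM⟩ := (A.image fun a => (l' a - c') / (c - l a)).bddAbove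
    refine ⟨M + 1, fun a ha hne => ?_⟩
    have hpos : 0 < c - l a := sub_pos.2 (lt_of_le_of_ne (hle a (hA a ha)) hne)
    rw [← div_lt_iff₀ hpos]
    have : (l' a - c') / (c - l a) ≤ M := hM (by simpa using ⟨a, ha, rfl⟩)
    linarith
  have hcases : ∀ a ∈ A, (l a = c ∧ l' a ≤ c') ∨ (l a ≠ c ∧ (N • l + l') a < N * c + c') := by
    intro a ha
    by_cases h : l a = c
    · exact Or.inl ⟨h, hle' a ⟨hA a ha, h⟩⟩
    · refine Or.inr ⟨h, ?_⟩
      have := hN a ha h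
      simp only [add_apply, smul_apply, smul_eq_mul]
      linarith
  have hval : ∀ a ∈ A, (N • l + l') a ≤ N * c + c' := by
    intro a ha
    rcases hcases a ha with ⟨h, h'⟩ | ⟨-, h⟩
    · simp only [add_apply, smul_apply, smul_eq_mul, h]
      linarith
    · exact h.le
  refine mem_faces_iff.2 ⟨N • l + l', N * c + c', le_of_mem_convexHull hval, ?_⟩
  rw [face_convexHull_eq hval]
  rw [face_convexHull_eq fun a ha => hle a (hA a ha)] at hle' ⊢
  rw [face_convexHull_eq fun a ha => hle' a (subset_convexHull ℝ _ ha), Finset.filter_filter]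
  congr 2
  refine Finset.filter_congr fun a ha => ?_
  rcases hcases a ha with ⟨h, h'⟩ | ⟨h, h'⟩
  · simp [h]
  · simp only [h, false_and, false_iff]
    exact h'.ne

theorem affDim_empty : affDim (∅ : Set E) = -1 := by simp [affDim]

theorem affDim_of_nonempty {A : Set E} (h : A.Nonempty) :
    affDim A = Module.finrank ℝ (affineSpan ℝ A).direction := by
  simp [affDim, h.ne_empty]

theorem neg_one_le_affDim (A : Set E) : -1 ≤ affDim A := by
  rcases A.eq_empty_or_nonempty with rfl | h
  · rw [affDim_empty]
  · rw [affDim_of_nonempty h]; omega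

theorem direction_affineSpan_le_ker {A : Set E} {f : E →L[ℝ] ℝ} {c : ℝ} (h : ∀ x ∈ A, f x = c) :
    (affineSpan ℝ A).direction ≤ LinearMap.ker (f : E →ₗ[ℝ] ℝ) := by
  rw [direction_affineSpan, vectorSpan_def, Submodule.span_le]
  rintro _ ⟨a, ha, b, hb, rfl⟩
  simp [h a ha, h b hb]

section FiniteDimensional

variable [FiniteDimensional ℝ E]

theorem affDim_le_finrank (A : Set E) : affDim A ≤ Module.finrank ℝ E := by
  rcases A.eq_empty_or_nonempty with rfl | h
  · rw [affDim_empty]; omega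
  · rw [affDim_of_nonempty h]; exact_mod_cast Submodule.finrank_le _

theorem affDim_mono_of_subset_affineSpan {A B : Set E} (h : A ⊆ affineSpan ℝ B) :
    affDim A ≤ affDim B := by
  rcases A.eq_empty_or_nonempty with rfl | hA
  · rw [affDim_empty]; exact neg_one_le_affDim B
  · have hB : B.Nonempty := (affineSpan_nonempty ℝ).1 (hA.mono h)
    rw [affDim_of_nonempty hA, affDim_of_nonempty hB]
    exact_mod_cast Submodule.finrank_mono (AffineSubspace.direction_le (affineSpan_le.2 h))

theorem affDim_insert_le (A : Set E) (p : E) : affDim (insert p A) ≤ affDim A + 1 := by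
  rw [affDim_of_nonempty (Set.insert_nonempty p A)]
  rcases A.eq_empty_or_nonempty with rfl | hA
  · simp [affDim_empty, direction_affineSpan]
  · rw [affDim_of_nonempty hA, ← affineSpan_insert_affineSpan, direction_affineSpan]
    exact_mod_cast finrank_vectorSpan_insert_le (affineSpan ℝ A) p

/-- A face strictly contained in a subset of `P` has strictly smaller dimension. -/
theorem affDim_lt_of_ssubset {P F B : Set E} (hF : F ∈ faces P) (hB : B ⊆ P) (h : F ⊂ B) :
    affDim F < affDim B := by
  obtain ⟨l, c, hle, rfl⟩ := mem_faces_iff.1 hF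
  obtain ⟨x, hxB, hxF⟩ := Set.exists_of_ssubset h
  have hlx : l x ≠ c := fun hc => hxF ⟨hB hxB, hc⟩
  set F := {x ∈ P | l x = c} with hFdef
  have hne : B.Nonempty := ⟨x, hxB⟩
  rw [affDim_of_nonempty hne]
  rcases F.eq_empty_or_nonempty with he | hFne
  · rw [he, affDim_empty]; omega
  rw [affDim_of_nonempty hFne]
  by_contra! hcon
  have hle' := affineSpan_mono ℝ h.subset
  have heq := AffineSubspace.eq_of_direction_eq_of_nonempty_of_le
    (Submodule.eq_of_le_of_finrank_le (AffineSubspace.direction_le hle') (by exact_mod_cast hcon))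
    ((affineSpan_nonempty ℝ).2 hFne) hle'
  have hx : x ∈ affineSpan ℝ F := heq ▸ subset_affineSpan ℝ B hxB
  obtain ⟨y, hy⟩ := hFne
  have hker : (affineSpan ℝ F).direction ≤ LinearMap.ker (l : E →ₗ[ℝ] ℝ) :=
    direction_affineSpan_le_ker fun x hx => hx.2
  have := hker (AffineSubspace.vsub_mem_direction hx (subset_affineSpan ℝ F hy))
  simp [hy.2, sub_eq_zero] at this
  exact hlx this

/-- A point outside the affine hull of a set can be separated from it by a functional that is
constant on the set. -/
theorem exists_functional_of_notMem_affineSpan {B : Set E} {s a : E} (hs : s ∈ B)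
    (ha : a ∉ affineSpan ℝ B) :
    ∃ f : E →L[ℝ] ℝ, (∀ b ∈ B, f b = f s) ∧ f s < f a := by
  have hsB := subset_affineSpan ℝ B hs
  have hnot : a - s ∉ (affineSpan ℝ B).direction := fun h => ha <| by
    simpa using AffineSubspace.vadd_mem_of_mem_direction h hsB
  obtain ⟨f, hf, hker⟩ := Submodule.exists_le_ker_of_notMem hnot
  have hconst : ∀ b ∈ B, f b = f s := fun b hb => by
    have := hker (AffineSubspace.vsub_mem_direction (subset_affineSpan ℝ B hb) hsB)
    simpa [sub_eq_zero] using this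
  rcases lt_or_gt_of_ne hf with h | h
  · refine ⟨-LinearMap.toContinuousLinearMap f, fun b hb => by simp [hconst b hb], ?_⟩
    simp only [map_sub] at h
    simpa using h
  · refine ⟨LinearMap.toContinuousLinearMap f, fun b hb => by simp [hconst b hb], ?_⟩
    simp only [map_sub] at h
    simpa using h

/-- If the face cut out by a valid inequality has codimension at least two, the inequality can be
tilted, leaving a given slack unchanged, so as to become tight at a further generator. -/
theorem exists_tilt {A : Finset E} {l : E →L[ℝ] ℝ} {c : ℝ} (h : ∀ a ∈ A, l a ≤ c) (s : E)
    (hdim : affDim {x ∈ convexHull ℝ (A : Set E) | l x = c} + 1 <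
      affDim (convexHull ℝ (A : Set E))) :
    ∃ (l' : E →L[ℝ] ℝ) (c' : ℝ), (∀ a ∈ A, l' a ≤ c') ∧ c' - l' s = c - l s ∧
      (∀ x ∈ convexHull ℝ (A : Set E), l x = c → l' x = c') ∧
      ∃ b ∈ A, l b ≠ c ∧ l' b = c' := by
  classical
  set G := {x ∈ convexHull ℝ (A : Set E) | l x = c} with hG
  obtain ⟨a, ha, hna⟩ : ∃ a ∈ A, a ∉ affineSpan ℝ (insert s G) := by
    by_contra! hcon
    have h1 : affDim (convexHull ℝ (A : Set E)) ≤ affDim (insert s G) :=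
      affDim_mono_of_subset_affineSpan
        (convexHull_min hcon (AffineSubspace.convex (affineSpan ℝ (insert s G))))
    have h2 := affDim_insert_le G s
    omega
  obtain ⟨f, hf, hfa⟩ := exists_functional_of_notMem_affineSpan (Set.mem_insert s G) hna
  -- Ratio test: the least ratio `t` is the largest multiple of `f` that can be added before some
  -- generator violates the inequality, and `b` is where it becomes tight.
  obtain ⟨b, hb, hmin⟩ := Finset.exists_min_image (A.filter fun x => f s < f x)
    (fun x => (c - l x) / (f x - f s)) ⟨a, Finset.mem_filter.2 ⟨ha, hfa⟩⟩
  obtain ⟨hbA, hfb⟩ := Finset.mem_filter.1 hb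
  set t := (c - l b) / (f b - f s) with ht
  have ht0 : 0 ≤ t := div_nonneg (sub_nonneg.2 (h b hbA)) (sub_pos.2 hfb).le
  refine ⟨l + t • f, c + t * f s, fun x hx => ?_, ?_, fun x hx hlx => ?_, b, hbA, fun hc => ?_, ?_⟩
  · simp only [add_apply, smul_apply, smul_eq_mul]
    rcases le_or_gt (f x) (f s) with hle | hlt
    · have := mul_le_mul_of_nonneg_left hle ht0
      linarith [h x hx]
    · have := hmin x (Finset.mem_filter.2 ⟨hx, hlt⟩)
      rw [le_div_iff₀ (sub_pos.2 hlt)] at this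
      linarith
  · simp only [add_apply, smul_apply, smul_eq_mul]
    ring
  · simp only [add_apply, smul_apply, smul_eq_mul, hlx,
      hf x (Set.mem_insert_of_mem _ ⟨hx, hlx⟩)]
  · exact hfb.ne' (hf b (Set.mem_insert_of_mem _ ⟨subset_convexHull ℝ _ hbA, hc⟩))
  · simp only [add_apply, smul_apply, smul_eq_mul]
    have : t * (f b - f s) = c - l b := div_mul_cancel₀ _ (sub_pos.2 hfb).ne'
    linarith

/-- A face of a polytope and a point of the polytope outside it are separated by a facet. -/
theorem exists_facet {P F : Set E} (hP : IsPolytope P) (hF : F ∈ faces P) {s : E} (hs : s ∈ P)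
    (hsF : s ∉ F) : ∃ G, IsFacet P G ∧ F ⊆ G ∧ s ∉ G := by
  classical
  obtain ⟨A, rfl⟩ := hP
  -- Induction on the number of generators that are not tight: each tilt lowers it and keeps `s`
  -- strictly slack.
  have key : ∀ (k : ℕ) (l : E →L[ℝ] ℝ) (c : ℝ), (∀ a ∈ A, l a ≤ c) → (∀ x ∈ F, l x = c) →
      l s < c → (A.filter fun a => l a ≠ c).card = k →
      ∃ G, IsFacet (convexHull ℝ (A : Set E)) G ∧ F ⊆ G ∧ s ∉ G := by
    intro k
    induction k using Nat.strong_induction_on with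
    | _ k ih =>
      intro l c hle hlF hls hk
      set G := {x ∈ convexHull ℝ (A : Set E) | l x = c} with hG
      have hGface : G ∈ faces (convexHull ℝ (A : Set E)) :=
        mem_faces_iff.2 ⟨l, c, le_of_mem_convexHull hle, rfl⟩
      have hsG : s ∉ G := fun h => hls.ne h.2
      have hlt : affDim G < affDim (convexHull ℝ (A : Set E)) :=
        affDim_lt_of_ssubset hGface subset_rfl
          ⟨subset_of_mem_faces hGface, fun h => hsG (h hs)⟩
      by_cases hdim : affDim G + 1 < affDim (convexHull ℝ (A : Set E))
      · obtain ⟨l', c', hle', hsl, htight, b, hb, hbl, hbl'⟩ := exists_tilt hle s hdim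
        refine ih _ ?_ l' c' hle'
          (fun x hx => htight x (subset_of_mem_faces hF hx) (hlF x hx)) (by linarith) rfl
        rw [← hk]
        refine Finset.card_lt_card ⟨fun x hx => ?_, fun hsub => ?_⟩
        · obtain ⟨hxA, hx⟩ := Finset.mem_filter.1 hx
          exact Finset.mem_filter.2
            ⟨hxA, fun hc => hx (htight x (subset_convexHull ℝ _ hxA) hc)⟩
        · exact (Finset.mem_filter.1 (hsub (Finset.mem_filter.2 ⟨hb, hbl⟩))).2 hbl'
      · exact ⟨G, ⟨hGface, by omega⟩,
          fun x hx => ⟨subset_of_mem_faces hF hx, hlF x hx⟩, hsG⟩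
  obtain ⟨l, c, hle, rfl⟩ := mem_faces_iff.1 hF
  exact key _ l c (fun a ha => hle a (subset_convexHull ℝ _ ha)) (fun x hx => hx.2)
    (lt_of_le_of_ne (hle s hs) fun hc => hsF ⟨hs, hc⟩) rfl

/-- Avoiding a finite set of points costs at most one dimension per point. -/
theorem exists_face_avoiding {P : Set E} (hP : IsPolytope P) {K : Set E} (hK : K ∈ faces P)
    (R : Finset E) :
    ∃ K' ∈ faces P, K' ⊆ K ∧ (∀ v ∈ R, v ∉ K') ∧ affDim K - R.card ≤ affDim K' := by
  classical
  induction R using Finset.induction_on with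
  | empty => exact ⟨K, hK, subset_rfl, by simp, by simp⟩
  | insert p R hp ih =>
    obtain ⟨K', hK', hsub, havoid, hdim⟩ := ih
    rw [Finset.card_insert_of_notMem hp]
    by_cases hpK : p ∈ K'
    · obtain ⟨G, hG, -, hpG⟩ :=
        exists_facet (hP.of_mem_faces hK') (empty_mem_faces K') hpK (Set.notMem_empty p)
      refine ⟨G, faces_trans hP hK' hG.1, (subset_of_mem_faces hG.1).trans hsub, ?_, ?_⟩
      · intro v hv hvG
        rcases Finset.mem_insert.1 hv with rfl | hv
        · exact hpG hvG
        · exact havoid v hv (subset_of_mem_faces hG.1 hvG)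
      · rw [hG.2]; push_cast; omega
    · refine ⟨K', hK', hsub, ?_, by push_cast; omega⟩
      intro v hv hvG
      rcases Finset.mem_insert.1 hv with rfl | hv
      · exact hpK hvG
      · exact havoid v hv hvG

end FiniteDimensional

end FaceTheory

/-! ### Consequences of being special: exposing functionals and separation -/

section SpecialToSeparating

variable {E : Type*} [NormedAddCommGroup E] [NormedSpace ℝ E] {P : Set E} {S : Finset E} {m : ℕ}

theorem IsPolytope.closure_convexHull_vertices (hP : IsPolytope P) :
    closure (convexHull ℝ (vertices P)) = P := by
  obtain ⟨A, rfl⟩ := hP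
  exact closure_convexHull_extremePoints (A.finite_toSet.isCompact_convexHull (𝕜 := ℝ))
    (convex_convexHull ℝ _)

theorem IsSpecialSimplex.nonempty (h : IsSpecialSimplex m P S) : S.Nonempty :=
  Finset.card_pos.1 (by rw [h.card_eq]; omega)

theorem IsSpecialSimplex.subset (h : IsSpecialSimplex m P S) : ∀ s ∈ S, s ∈ P :=
  fun _ hs => (h.subset_vertices hs).1

theorem IsSpecialSimplex.exists_notMem_facet (h : IsSpecialSimplex m P S) {G : Set E}
    (hG : IsFacet P G) : ∃ s ∈ S, s ∉ G := by
  by_contra! hcon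
  have := h.facet_inter G hG
  rw [Set.inter_eq_left.2 hcon, Set.ncard_coe_finset, h.card_eq] at this
  omega

theorem IsSpecialSimplex.mem_facet_of_ne (h : IsSpecialSimplex m P S) {G : Set E}
    (hG : IsFacet P G) {s : E} (hs : s ∈ S) (hsG : s ∉ G) {t : E} (ht : t ∈ S) (hts : t ≠ s) :
    t ∈ G := by
  classical
  have hsub : (S : Set E) ∩ G ⊆ (S.erase s : Finset E) := fun x hx =>
    Finset.mem_coe.2 (Finset.mem_erase.2 ⟨fun hxs => hsG (hxs ▸ hx.2), hx.1⟩)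
  have heq := Set.eq_of_subset_of_ncard_le hsub (by
    rw [h.facet_inter G hG, Set.ncard_coe_finset, Finset.card_erase_of_mem hs, h.card_eq]
    simp) (Finset.finite_toSet _)
  have : t ∈ (S : Set E) ∩ G := by
    rw [heq]
    exact Finset.mem_coe.2 (Finset.mem_erase.2 ⟨hts, ht⟩)
  exact this.2

/-- On a special simplex, the suitably scaled slack of a facet is a barycentric coordinate. -/
theorem IsSpecialSimplex.exists_normalized (h : IsSpecialSimplex m P S) {G : Set E}
    (hG : IsFacet P G) {s : E} (hs : s ∈ S) (hsG : s ∉ G) :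
    ∃ (l : E →L[ℝ] ℝ) (c : ℝ), (∀ x ∈ P, l x ≤ c) ∧ G = {x ∈ P | l x = c} ∧ c - l s = 1 ∧
      ∀ t ∈ S, t ≠ s → l t = c := by
  obtain ⟨l, c, hle, hGeq⟩ := mem_faces_iff.1 hG.1
  have hpos : 0 < c - l s := by
    refine sub_pos.2 (lt_of_le_of_ne (hle s (h.subset s hs)) fun hc => hsG ?_)
    rw [hGeq]
    exact ⟨h.subset s hs, hc⟩
  have hinv : 0 < (c - l s)⁻¹ := inv_pos.2 hpos
  refine ⟨(c - l s)⁻¹ • l, (c - l s)⁻¹ * c, fun x hx => ?_, ?_, ?_, fun t ht hts => ?_⟩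
  · exact mul_le_mul_of_nonneg_left (hle x hx) hinv.le
  · rw [hGeq]
    ext x
    simp [hpos.ne']
  · simp only [smul_apply, smul_eq_mul, ← mul_sub]
    exact inv_mul_cancel₀ hpos.ne'
  · have := h.mem_facet_of_ne hG hs hsG ht hts
    rw [hGeq] at this
    simp [this.2]

variable [FiniteDimensional ℝ E]

/-- Sum of the normalized facet slacks, one facet through `F` for each `s`. The facet for one index
`s₀` is chosen to miss `x`, which makes the sum strict at `x`. -/
theorem IsSpecialSimplex.exists_valid_const (h : IsSpecialSimplex m P S) (hP : IsPolytope P)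
    {F : Set E} (hF : F ∈ deletion P S) {x : E} (hx : x ∈ P) (hxF : x ∉ F) :
    ∃ (l : E →L[ℝ] ℝ) (c : ℝ), (∀ y ∈ P, l y ≤ c) ∧ (∀ y ∈ F, l y = c) ∧ l x < c ∧
      ∀ s ∈ S, c - l s = 1 := by
  classical
  obtain ⟨G₀, hG₀, hFG₀, hxG₀⟩ := exists_facet hP hF.1 hx hxF
  obtain ⟨s₀, hs₀, hs₀G⟩ := h.exists_notMem_facet hG₀
  have hfacet : ∀ s ∈ S, ∃ G, IsFacet P G ∧ F ⊆ G ∧ s ∉ G ∧ (s = s₀ → x ∉ G) := by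
    intro s hs
    by_cases hss : s = s₀
    · subst hss
      exact ⟨G₀, hG₀, hFG₀, hs₀G, fun _ => hxG₀⟩
    · obtain ⟨G, hG, hFG, hsG⟩ := exists_facet hP hF.1 (h.subset s hs) (hF.2 s hs)
      exact ⟨G, hG, hFG, hsG, fun hc => absurd hc hss⟩
  have hfun : ∀ s, ∃ (l : E →L[ℝ] ℝ) (c : ℝ), s ∈ S → (∀ y ∈ P, l y ≤ c) ∧ (∀ y ∈ F, l y = c) ∧
      c - l s = 1 ∧ (∀ t ∈ S, t ≠ s → l t = c) ∧ (s = s₀ → l x < c) := by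
    intro s
    by_cases hs : s ∈ S
    · obtain ⟨G, hG, hFG, hsG, hxG⟩ := hfacet s hs
      obtain ⟨l, c, hle, hGeq, h1, h2⟩ := h.exists_normalized hG hs hsG
      rw [hGeq] at hFG hxG
      exact ⟨l, c, fun _ => ⟨hle, fun y hy => (hFG hy).2, h1, h2, fun hss =>
        lt_of_le_of_ne (hle x hx) fun hc => hxG hss ⟨hx, hc⟩⟩⟩
    · exact ⟨0, 0, fun hc => absurd hc hs⟩
  choose L C hLC using hfun
  refine ⟨∑ s ∈ S, L s, ∑ s ∈ S, C s, fun y hy => ?_, fun y hy => ?_, ?_, fun s hs => ?_⟩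
  · rw [sum_apply]
    exact Finset.sum_le_sum fun s hs => (hLC s hs).1 y hy
  · rw [sum_apply]
    exact Finset.sum_congr rfl fun s hs => (hLC s hs).2.1 y hy
  · rw [sum_apply]
    exact Finset.sum_lt_sum (fun s hs => (hLC s hs).1 x hx)
      ⟨s₀, hs₀, (hLC s₀ hs₀).2.2.2.2 rfl⟩
  · rw [sum_apply, ← Finset.sum_sub_distrib, Finset.sum_eq_single_of_mem s hs]
    · exact (hLC s hs).2.2.1
    · exact fun t ht hts => sub_eq_zero.2 ((hLC t ht).2.2.2.1 s hs hts.symm).symm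

/-- A face missing the special simplex is cut out by an inequality whose left-hand side is constant
on the simplex. -/
theorem IsSpecialSimplex.exists_exposing_const (h : IsSpecialSimplex m P S) (hP : IsPolytope P)
    {F : Set E} (hF : F ∈ deletion P S) :
    ∃ (l : E →L[ℝ] ℝ) (c d : ℝ), (∀ y ∈ P, l y ≤ c) ∧ F = {y ∈ P | l y = c} ∧
      ∀ s ∈ S, l s = d := by
  classical
  have hP' := hP
  obtain ⟨A, rfl⟩ := hP
  have hA : ∀ a ∈ A, a ∈ convexHull ℝ (A : Set E) := fun a ha => subset_convexHull ℝ _ ha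
  set B := A.filter fun a => a ∉ F with hB
  have hfun : ∀ x, ∃ (l : E →L[ℝ] ℝ) (c : ℝ), x ∈ B → (∀ y ∈ convexHull ℝ (A : Set E), l y ≤ c) ∧
      (∀ y ∈ F, l y = c) ∧ l x < c ∧ ∀ s ∈ S, c - l s = 1 := by
    intro x
    by_cases hx : x ∈ B
    · obtain ⟨hxA, hxF⟩ := Finset.mem_filter.1 hx
      obtain ⟨l, c, hlc⟩ := h.exists_valid_const hP' hF (hA x hxA) hxF
      exact ⟨l, c, fun _ => hlc⟩
    · exact ⟨0, 0, fun hc => absurd hc hx⟩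
  choose L C hLC using hfun
  have hval : ∀ y ∈ convexHull ℝ (A : Set E), (∑ x ∈ B, L x) y ≤ ∑ x ∈ B, C x := by
    intro y hy
    rw [sum_apply]
    exact Finset.sum_le_sum fun x hx => (hLC x hx).1 y hy
  -- Each summand has slack 1 on `S`, and every generator off `F` is strict in its own summand.
  refine ⟨∑ x ∈ B, L x, ∑ x ∈ B, C x, ∑ x ∈ B, (C x - 1), hval, ?_, fun s hs => ?_⟩
  · refine eq_face_of_tight_iff hF.1 (fun a ha => hval a (hA a ha)) fun a ha =>
      ⟨fun heq => ?_, fun haF => ?_⟩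
    · by_contra haF
      have haB : a ∈ B := Finset.mem_filter.2 ⟨ha, haF⟩
      refine absurd heq (ne_of_lt ?_)
      rw [sum_apply]
      exact Finset.sum_lt_sum (fun x hx => (hLC x hx).1 a (hA a ha)) ⟨a, haB, (hLC a haB).2.2.1⟩
    · rw [sum_apply]
      exact Finset.sum_congr rfl fun x hx => (hLC x hx).2.1 a haF
  · rw [sum_apply]
    exact Finset.sum_congr rfl fun x hx => by linarith [(hLC x hx).2.2.2 s hs]

theorem eq_zero_of_const_of_affDim_eq (hdim : affDim P = Module.finrank ℝ E)
    {f : E →L[ℝ] ℝ} {c : ℝ} (hf : ∀ x ∈ P, f x = c) : f = 0 := by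
  have hne : P.Nonempty := by
    rw [Set.nonempty_iff_ne_empty]
    rintro rfl
    rw [affDim_empty] at hdim
    omega
  rw [affDim_of_nonempty hne] at hdim
  have htop : (affineSpan ℝ P).direction = ⊤ :=
    Submodule.eq_top_of_finrank_eq (by exact_mod_cast hdim)
  ext x
  simpa using direction_affineSpan_le_ker hf (htop ▸ Submodule.mem_top : x ∈ _)

/-- Otherwise `f ≤ c` is valid on `P` and cuts out a face containing `S`, proper because `P` is
full-dimensional; a facet above it would contain all of `S`. -/
theorem IsSpecialSimplex.exists_vertex_gt (h : IsSpecialSimplex m P S) (hP : IsPolytope P)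
    (hdim : affDim P = Module.finrank ℝ E) {f : E →L[ℝ] ℝ} {c : ℝ} (hf : f ≠ 0)
    (hS : ∀ s ∈ S, f s = c) : ∃ v ∈ vertices P \ (S : Set E), c < f v := by
  by_contra! hcon
  have hV : vertices P ⊆ {x | f x ≤ c} := fun v hv => by
    by_cases hvS : v ∈ S
    · exact (hS v hvS).le
    · exact hcon v ⟨hv, hvS⟩
  have hle : ∀ x ∈ P, f x ≤ c := by
    rw [← hP.closure_convexHull_vertices]
    exact closure_minimal (convexHull_min hV (convex_halfSpace_le f.isLinear c))
      (isClosed_le f.continuous continuous_const)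
  obtain ⟨x, hx, hxc⟩ : ∃ x ∈ P, f x ≠ c := by
    by_contra! hall
    exact hf (eq_zero_of_const_of_affDim_eq hdim hall)
  obtain ⟨G, hG, hFG, -⟩ := exists_facet hP (mem_faces_iff.2 ⟨f, c, hle, rfl⟩) hx
    fun hc => hxc hc.2
  obtain ⟨s, hs, hsG⟩ := h.exists_notMem_facet hG
  exact hsG (hFG ⟨h.subset s hs, hS s hs⟩)

theorem IsSpecialSimplex.hyperplanesSeparate (h : IsSpecialSimplex m P S) (hP : IsPolytope P)
    (hdim : affDim P = Module.finrank ℝ E) : HyperplanesSeparate P S := by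
  intro f c hf hS
  have hS' : ∀ s ∈ S, f s = c := fun s hs => hS (subset_convexHull ℝ _ hs)
  obtain ⟨v, hv, hcv⟩ := h.exists_vertex_gt hP hdim hf hS'
  obtain ⟨w, hw, hcw⟩ := h.exists_vertex_gt hP hdim (f := -f) (c := -c) (neg_ne_zero.2 hf)
    fun s hs => by simp [hS' s hs]
  exact ⟨v, hv, w, hw, hcv, by simpa using hcw⟩

end SpecialToSeparating

/-! ### Faces under projection, and dimension bounds from the isomorphism -/

section Projection

variable {E E' : Type*} [NormedAddCommGroup E] [NormedSpace ℝ E]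
  [NormedAddCommGroup E'] [NormedSpace ℝ E']
  {P : Set E} {S : Finset E} {m : ℕ} {π : E →ₗ[ℝ] E'}

theorem exists_factor [FiniteDimensional ℝ E'] (hsurj : Function.Surjective π) {l : E →L[ℝ] ℝ}
    (hker : LinearMap.ker π ≤ LinearMap.ker (l : E →ₗ[ℝ] ℝ)) :
    ∃ g : E' →L[ℝ] ℝ, ∀ x, g (π x) = l x := by
  obtain ⟨σ, hσ⟩ := π.exists_rightInverse_of_surjective (LinearMap.range_eq_top.2 hsurj)
  refine ⟨LinearMap.toContinuousLinearMap ((l : E →ₗ[ℝ] ℝ) ∘ₗ σ), fun x => ?_⟩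
  have hmem : σ (π x) - x ∈ LinearMap.ker π := by
    rw [LinearMap.mem_ker, map_sub, sub_eq_zero]
    exact LinearMap.congr_fun hσ (π x)
  have := hker hmem
  simpa [sub_eq_zero] using this

/-- Faces of a linear image pull back to faces. -/
theorem preimage_inter_mem_faces [FiniteDimensional ℝ E] {G : Set E'} (hG : G ∈ faces (π '' P)) :
    π ⁻¹' G ∩ P ∈ faces P := by
  obtain ⟨g, c, hle, rfl⟩ := mem_faces_iff.1 hG
  refine mem_faces_iff.2 ⟨g ∘L LinearMap.toContinuousLinearMap π, c,
    fun x hx => hle _ (Set.mem_image_of_mem π hx), ?_⟩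
  ext x
  constructor
  · exact fun hx => ⟨hx.2, hx.1.2⟩
  · exact fun hx => ⟨⟨Set.mem_image_of_mem π hx.1, hx.2⟩, hx.1⟩

/-- Since `π` is constant on `S`, a preimage meeting `S` would lie in a supporting hyperplane
containing all of `S`, contradicting separation. -/
theorem preimage_inter_mem_deletion [FiniteDimensional ℝ E] (hsep : HyperplanesSeparate P S)
    (hconst : ∀ s ∈ S, ∀ t ∈ S, π s = π t) {G : Set E'} (hG : G ∈ boundaryComplex (π '' P)) : π ⁻¹' G ∩ P ∈ deletion P S := by
  refine ⟨preimage_inter_mem_faces hG.1, fun s hs hsG => ?_⟩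
  obtain ⟨g, c, hle, hGeq⟩ := mem_faces_iff.1 hG.1
  have hgs : g (π s) = c := by
    have := hsG.1
    rw [hGeq] at this
    exact this.2
  -- A vanishing functional would force `c = 0` and hence make `G` the whole image.
  have hne : g ∘L LinearMap.toContinuousLinearMap π ≠ 0 := by
    intro h0
    have hg : ∀ x, g (π x) = 0 := fun x => DFunLike.congr_fun h0 x
    apply hG.2
    rw [hGeq]
    refine Set.Subset.antisymm (fun y hy => hy.1) ?_
    rintro _ ⟨x, hx, rfl⟩
    exact ⟨Set.mem_image_of_mem π hx, by rw [hg, ← hgs, hg]⟩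
  obtain ⟨v, hv, -, -, hcv, -⟩ := hsep _ c hne (convexHull_min (fun t ht => by
    change g (π t) = c
    rw [hconst t ht s hs, hgs])
    (convex_hyperplane (g ∘L LinearMap.toContinuousLinearMap π).isLinear c))
  exact absurd (hle _ (Set.mem_image_of_mem π hv.1.1)) (not_le.2 hcv)

theorem not_subset_facet_of_hyperplanesSeparate (hsep : HyperplanesSeparate P S)
    (hS : S.Nonempty) {F : Set E} (hF : IsFacet P F) : ¬ (S : Set E) ⊆ F := by
  intro hSF
  obtain ⟨l, c, hle, hFeq⟩ := mem_faces_iff.1 hF.1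
  have hSl : ∀ s ∈ S, l s = c := fun s hs => by
    have := hSF hs
    rw [hFeq] at this
    exact this.2
  have hl : l ≠ 0 := by
    rintro rfl
    obtain ⟨s, hs⟩ := hS
    obtain rfl : 0 = c := by simpa using hSl s hs
    have hFP : F = P := by simpa using hFeq
    have := hF.2
    rw [hFP] at this
    omega
  obtain ⟨v, hv, -, -, hcv, -⟩ :=
    hsep l c hl (convexHull_min hSl (convex_hyperplane l.isLinear c))
  exact absurd (hle v hv.1.1) (not_le.2 hcv)

variable [FiniteDimensional ℝ E] [FiniteDimensional ℝ E']

theorem IsSpecialSimplex.image_deletion (h : IsSpecialSimplex m P S) (hP : IsPolytope P)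
    (hsurj : Function.Surjective π)
    (hker : LinearMap.ker π = (affineSpan ℝ (S : Set E)).direction) {F : Set E}
    (hF : F ∈ deletion P S) : π '' F ∈ boundaryComplex (π '' P) ∧ π ⁻¹' (π '' F) ∩ P = F := by
  obtain ⟨l, c, d, hle, hFeq, hd⟩ := h.exists_exposing_const hP hF
  obtain ⟨g, hg⟩ := exists_factor hsurj (hker.le.trans (direction_affineSpan_le_ker hd))
  have hsat : π ⁻¹' (π '' F) ∩ P = F := by
    refine Set.Subset.antisymm ?_ fun x hx =>
      ⟨Set.mem_image_of_mem π hx, subset_of_mem_faces hF.1 hx⟩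
    rintro x ⟨⟨y, hy, hyx⟩, hx⟩
    rw [hFeq] at hy ⊢
    exact ⟨hx, by rw [← hg, ← hyx, hg, hy.2]⟩
  refine ⟨⟨mem_faces_iff.2 ⟨g, c, ?_, ?_⟩, fun heq => ?_⟩, hsat⟩
  · rintro _ ⟨x, hx, rfl⟩
    rw [hg]
    exact hle x hx
  · rw [hFeq]
    ext y
    constructor
    · rintro ⟨x, hx, rfl⟩
      exact ⟨Set.mem_image_of_mem π hx.1, by rw [hg, hx.2]⟩
    · rintro ⟨⟨x, hx, rfl⟩, hy⟩
      exact Set.mem_image_of_mem π ⟨hx, by rw [← hg, hy]⟩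
  · obtain ⟨s, hs⟩ := h.nonempty
    have hsP := h.subset s hs
    apply hF.2 s hs
    rw [← hsat, heq]
    exact ⟨Set.mem_image_of_mem π hsP, hsP⟩

theorem IsSpecialSimplex.isomorphic_image (h : IsSpecialSimplex m P S) (hP : IsPolytope P)
    (hdim : affDim P = Module.finrank ℝ E) (hsurj : Function.Surjective π)
    (hker : LinearMap.ker π = (affineSpan ℝ (S : Set E)).direction) :
    Isomorphic (deletion P S) (boundaryComplex (π '' P)) := by
  have hconst : ∀ s ∈ S, ∀ t ∈ S, π s = π t := fun s hs t ht => by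
    rw [← sub_eq_zero, ← map_sub, ← LinearMap.mem_ker, hker]
    exact AffineSubspace.vsub_mem_direction (subset_affineSpan ℝ _ hs) (subset_affineSpan ℝ _ ht)
  have hsep := h.hyperplanesSeparate hP hdim
  have himage := fun {F : Set E} (hF : F ∈ deletion P S) => h.image_deletion hP hsurj hker hF
  exact ⟨{
    toFun := fun F => ⟨π '' F, (himage F.2).1⟩
    invFun := fun G => ⟨π ⁻¹' G ∩ P, preimage_inter_mem_deletion hsep hconst G.2⟩
    left_inv := fun F => Subtype.ext (himage F.2).2
    right_inv := fun G => Subtype.ext <| by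
      change π '' (π ⁻¹' G ∩ P) = G
      rw [Set.inter_comm, Set.image_inter_preimage,
        Set.inter_eq_right.2 (subset_of_mem_faces G.2.1)]
    map_rel_iff' := fun {F F'} => by
      refine ⟨fun hle => ?_, fun hle => Set.image_mono hle⟩
      change (F : Set E) ⊆ F'
      rw [← (himage F.2).2, ← (himage F'.2).2]
      exact Set.inter_subset_inter_left _ (Set.preimage_mono hle) }⟩

/-- A strictly monotone map between complexes of faces does not lower dimensions. -/
theorem affDim_le_of_strictMono (hP : IsPolytope P) {Q : Set E'}
    (φ : deletion P S → boundaryComplex Q) (hφ : StrictMono φ) :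
    -- The shift by one makes the empty face the base case; the inductive step passes to a facet of
    -- `K`.
    ∀ (k : ℕ) (K : deletion P S), affDim (K : Set E) = k - 1 →
      affDim (K : Set E) ≤ affDim (φ K : Set E') := by
  intro k
  induction k with
  | zero =>
    intro K hK
    rw [hK]
    simpa using neg_one_le_affDim _
  | succ k ih =>
    intro K hK
    obtain ⟨p, hp⟩ : (K : Set E).Nonempty := by
      rw [Set.nonempty_iff_ne_empty]
      intro he
      rw [he, affDim_empty] at hK
      push_cast at hK
      omega
    obtain ⟨G, hG, -, hpG⟩ := exists_facet (hP.of_mem_faces K.2.1) (empty_mem_faces _) hp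
      (Set.notMem_empty p)
    have hGK := subset_of_mem_faces hG.1
    have hGdel : G ∈ deletion P S :=
      ⟨faces_trans hP K.2.1 hG.1, fun v hv hvG => K.2.2 v hv (hGK hvG)⟩
    have hGdim := hG.2
    have h1 := ih ⟨G, hGdel⟩ (by rw [hGdim, hK]; push_cast; ring)
    have hlt : (⟨G, hGdel⟩ : deletion P S) < K :=
      lt_of_le_of_ne hGK fun heq => hpG (by rw [← heq] at hp; exact hp)
    have h2 := affDim_lt_of_ssubset (φ ⟨G, hGdel⟩).2.1 (subset_of_mem_faces (φ K).2.1) (hφ hlt)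
    have h3 : affDim ((⟨G, hGdel⟩ : deletion P S) : Set E) = affDim G := rfl
    omega

theorem affDim_lt_finrank_of_isomorphic (hP : IsPolytope P) {Q : Set E'}
    (hiso : Isomorphic (deletion P S) (boundaryComplex Q)) {K : Set E} (hK : K ∈ deletion P S) :
    affDim K < Module.finrank ℝ E' := by
  obtain ⟨φ⟩ := hiso
  have h1 := affDim_le_of_strictMono hP φ φ.strictMono (affDim K + 1).toNat ⟨K, hK⟩ (by
    have := neg_one_le_affDim K
    change affDim K = _
    omega)
  have hmem := (φ ⟨K, hK⟩).2
  have h2 := affDim_lt_of_ssubset hmem.1 subset_rfl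
    ((subset_of_mem_faces hmem.1).ssubset_of_ne hmem.2)
  have h3 := affDim_le_finrank Q
  exact (h1.trans_lt h2).trans_le h3

theorem le_ncard_inter_facet_of_isomorphic (hP : IsPolytope P) {Q : Set E'}
    (hiso : Isomorphic (deletion P S) (boundaryComplex Q)) {F : Set E} (hF : IsFacet P F) :
    affDim P ≤ Module.finrank ℝ E' + ((S : Set E) ∩ F).ncard := by
  classical
  obtain ⟨K, hK, hKF, havoid, hdim⟩ := exists_face_avoiding hP hF.1 (S.filter fun v => v ∈ F)
  have hKdel : K ∈ deletion P S :=
    ⟨hK, fun v hv hvK => havoid v (Finset.mem_filter.2 ⟨hv, hKF hvK⟩) hvK⟩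
  have hlt := affDim_lt_finrank_of_isomorphic hP hiso hKdel
  have hcard : ((S : Set E) ∩ F).ncard = (S.filter fun v => v ∈ F).card := by
    rw [← Set.ncard_coe_finset, Finset.coe_filter]
    rfl
  have := hF.2
  omega

end Projection

/-! ### Linear algebra in coordinates and the equivalence -/

theorem exists_projection {n m : ℕ} (W : Submodule ℝ (EuclideanSpace ℝ (Fin n)))
    (hW : Module.finrank ℝ W = m) :
    ∃ π : EuclideanSpace ℝ (Fin n) →ₗ[ℝ] EuclideanSpace ℝ (Fin (n - m)),
      Function.Surjective π ∧ LinearMap.ker π = W := by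
  have hq := Submodule.finrank_quotient_add_finrank W
  rw [hW, finrank_euclideanSpace_fin] at hq
  let e := LinearEquiv.ofFinrankEq (EuclideanSpace ℝ (Fin n) ⧸ W) (EuclideanSpace ℝ (Fin (n - m)))
    (by rw [finrank_euclideanSpace_fin]; omega)
  refine ⟨e.toLinearMap ∘ₗ W.mkQ, e.surjective.comp W.mkQ_surjective, ?_⟩
  rw [LinearEquiv.ker_comp, Submodule.ker_mkQ]

theorem affineIndependent_iff_finrank_direction {E : Type*} [NormedAddCommGroup E]
    [NormedSpace ℝ E] {S : Finset E} {m : ℕ} (hcard : S.card = m + 1) :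
    AffineIndependent ℝ (fun v : S => (v : E)) ↔
      Module.finrank ℝ (affineSpan ℝ (S : Set E)).direction = m := by
  rw [affineIndependent_iff_finrank_vectorSpan_eq ℝ _ (n := m) (by simpa using hcard),
    direction_affineSpan, Subtype.range_coe_subtype]
  rfl

end SpecialSimplex

theorem mainTheorem2 (n m : ℕ) (hm : 1 ≤ m) (hmn : m ≤ n - 1)
    (P : Set (EuclideanSpace ℝ (Fin n))) (hP : SpecialSimplex.IsPolytope P)
    (hdim : SpecialSimplex.affDim P = n)
    (S : Finset (EuclideanSpace ℝ (Fin n)))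
    (hS : (S : Set (EuclideanSpace ℝ (Fin n))) ⊆ SpecialSimplex.vertices P)
    (hcard : S.card = m + 1) :
    SpecialSimplex.IsSpecialSimplex m P S ↔
      SpecialSimplex.HyperplanesSeparate P S ∧
      ∃ Q : Set (EuclideanSpace ℝ (Fin (n - m))),
        SpecialSimplex.IsBasisPolytope m P S Q ∧
        SpecialSimplex.Isomorphic (SpecialSimplex.deletion P S)
          (SpecialSimplex.boundaryComplex Q) := by
  constructor
  · intro h
    have hdim' : SpecialSimplex.affDim P = Module.finrank ℝ (EuclideanSpace ℝ (Fin n)) := by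
      rw [hdim, finrank_euclideanSpace_fin]
    obtain ⟨π, hsurj, hker⟩ := SpecialSimplex.exists_projection _
      ((SpecialSimplex.affineIndependent_iff_finrank_direction hcard).1 h.affineIndependent)
    exact ⟨h.hyperplanesSeparate hP hdim', π '' P, ⟨π, hsurj, hker, rfl⟩,
      h.isomorphic_image hP hdim' hsurj hker⟩
  · rintro ⟨hsep, Q, ⟨π, hsurj, hker, -⟩, hiso⟩
    refine ⟨hS, hcard, ?_, fun F hF => le_antisymm ?_ ?_⟩
    · rw [SpecialSimplex.affineIndependent_iff_finrank_direction hcard, ← hker]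
      have hrank := π.finrank_range_add_finrank_ker
      rw [LinearMap.range_eq_top.2 hsurj, finrank_top, finrank_euclideanSpace_fin,
        finrank_euclideanSpace_fin] at hrank
      omega
    · have hnot := SpecialSimplex.not_subset_facet_of_hyperplanesSeparate hsep
        (Finset.card_pos.1 (by omega)) hF
      have hlt := Set.ncard_lt_ncard (Set.inter_ssubset_left_iff.2 hnot) S.finite_toSet
      rw [Set.ncard_coe_finset, hcard] at hlt
      omega
    · have hle := SpecialSimplex.le_ncard_inter_facet_of_isomorphic hP hiso hF
      rw [hdim, finrank_euclideanSpace_fin] at hle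
      omega
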